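/- For $k\ge 1$ and $p\in(0,1)$ let $\mathrm{nb}(k,p)(x)=\binom{k+x-1}{x}p^k(1-p)^x$, $x=0,1,2,\ldots$, be the probability function of the negative binomial distribution $\mathrm{NegBin}(k,p)$. Let $N$ be a random variable with values in $\{1,2,\ldots\}$, probability function $f_N$, tail $\overline F_N(k)=P(N>k)$ and $E(N)<\infty$, and let $\boldsymbol\pi=(f_N(1),f_N(2),\ldots)$. The distribution $\mathrm{NBM}(\boldsymbol\pi,p)$ on $\{0,1,2,\ldots\}$ has probability function $f(x)=\sum_{k\ge1}f_N(k)\,\mathrm{nb}(k,p)(x)$. Consider the Gerber–Dickson risk process $U(t)=u+t-\sum_{i=1}^t Y_i$, $t=0,1,2,\ldots$, with integer initial capital $u\ge 0$ and i.i.d. claims $Y_1,Y_2,\ldots$ with distribution $\mathrm{NBM}(\boldsymbol\pi,p)$, under the net profit condition $E(Y_1)<1$. Let $\tau=\min\{t\ge1: U(t)\le0\}$ (with $\tau=\infty$ if there is no such $t$) and let $\psi(u)=P(\tau<\infty\mid U(0)=u)$ be the probability of ultimate ruin. Define $f_{Ne}(i)=\overline F_N(i-1)/E(N)$ for $i\ge1$,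 $\overline F_{Ne}(k)=1-\sum_{i=1}^k f_{Ne}(i)$, and the sequence $(\overline C_k)_{k\ge0}$ recursively by $$\overline C_0=E(N)\,\frac{1-p}{p},\qquad \overline C_k=\overline C_0\Big[\sum_{i=1}^k f_{Ne}(i)\,\overline C_{k-i}+\overline F_{Ne}(k)\Big],\quad k\ge1.$$ Then, for every $u\ge1$ and $Z_u\sim\mathrm{NegBin}(u,1-p)$, the series and the expectation below converge absolutely and $$\psi(u)=\sum_{k=0}^\infty \overline C_k\,P(Z_u=k)=E\big(\overline C_{Z_u}\big).$$ -/

import Mathlib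

open MeasureTheory ProbabilityTheory Finset

open scoped ENNReal

namespace GerberDickson

noncomputable section

/-! ### The Gerber–Dickson risk process -/

/-- The Gerber–Dickson risk process `U(t) = u + t - ∑_{i=1}^t Y_i`. The claim of period `i + 1` is
`Y i`, so that `Y 0, …, Y (t - 1)` are the claims of the first `t` periods. -/
def riskProcess {Ω : Type*} (Y : ℕ → Ω → ℕ) (u t : ℕ) (ω : Ω) : ℤ :=
  (u : ℤ) + (t : ℤ) - ∑ i ∈ range t, (Y i ω : ℤ)

/-- The time of ruin `τ = min {t ≥ 1 : U(t) ≤ 0}`, equal to `⊤` if there is no such `t`. -/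
def ruinTime {Ω : Type*} (Y : ℕ → Ω → ℕ) (u : ℕ) (ω : Ω) : ℕ∞ :=
  ⨅ (t : ℕ) (_ : 1 ≤ t ∧ riskProcess Y u t ω ≤ 0), (t : ℕ∞)

/-- The probability of ultimate ruin `ψ(u) = P(τ < ∞)` with initial capital `U(0) = u`. -/
def ruinProb {Ω : Type*} [MeasurableSpace Ω] (P : Measure Ω) (Y : ℕ → Ω → ℕ) (u : ℕ) : ℝ :=
  P.real {ω | ruinTime Y u ω < ⊤}

/-! ### Negative binomial distributions and their mixtures -/

/-- The negative binomial probability function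
`nb(k, p)(x) = binom(k + x - 1, x) p ^ k (1 - p) ^ x`, for `k ≥ 1`. -/
def nb (k : ℕ) (p : ℝ) (x : ℕ) : ℝ :=
  ((k + x - 1).choose x : ℝ) * p ^ k * (1 - p) ^ x

/-- The distribution on `{0, 1, 2, …}` with probability function `f`. -/
def lawOfPmf (f : ℕ → ℝ) : Measure ℕ :=
  Measure.sum fun x => ENNReal.ofReal (f x) • Measure.dirac x

/-- The negative binomial distribution `NegBin(k, p)`. -/
def negBin (k : ℕ) (p : ℝ) : Measure ℕ := lawOfPmf (nb k p)

/-- The probability function `f(x) = ∑_{k ≥ 1} q_k nb(k, p)(x)` of a negative binomial mixture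
(the value `q 0` is not used). -/
def nbmPmf (q : ℕ → ℝ) (p : ℝ) (x : ℕ) : ℝ :=
  ∑' k : ℕ, q (k + 1) * nb (k + 1) p x

/-- The negative binomial mixture distribution `NBM((q_1, q_2, …), p)`. -/
def nbm (q : ℕ → ℝ) (p : ℝ) : Measure ℕ := lawOfPmf (nbmPmf q p)

/-! ### Quantities derived from a random variable `N` with values in `{1, 2, …}` -/

section counting

variable {Ω : Type*} [MeasurableSpace Ω] (Q : Measure Ω) (N : Ω → ℕ)

/-- The probability function `f_N(k) = P(N = k)`. -/
def pmfOf (k : ℕ) : ℝ := Q.real {ω | N ω = k}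

/-- The tail `F̄_N(k) = P(N > k)`. -/
def tailOf (k : ℕ) : ℝ := Q.real {ω | k < N ω}

/-- The expectation `E(N)`. -/
def meanOf : ℝ := ∫ ω, (N ω : ℝ) ∂Q

/-- The equilibrium probability function `f_{Ne}(i) = F̄_N(i - 1) / E(N)`, for `i ≥ 1`. -/
def eqPmf (i : ℕ) : ℝ := tailOf Q N (i - 1) / meanOf Q N

/-- The tail `F̄_{Ne}(k) = 1 - ∑_{i=1}^k f_{Ne}(i)` of the equilibrium distribution. -/
def eqTail (k : ℕ) : ℝ := 1 - ∑ i ∈ Icc 1 k, eqPmf Q N i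

/-- The sequence `C̄_k`. The recursion is written with the summation index shifted by one; its
usual form is `cbar_zero` and `cbar_of_pos` below. -/
def cbar (p : ℝ) : ℕ → ℝ
  | 0 => meanOf Q N * (1 - p) / p
  | k + 1 => meanOf Q N * (1 - p) / p *
      (∑ j : Fin (k + 1), eqPmf Q N (j + 1) * cbar p (k - j) + eqTail Q N (k + 1))
  termination_by k => k

theorem cbar_zero (p : ℝ) : cbar Q N p 0 = meanOf Q N * (1 - p) / p := by
  rw [cbar]

theorem cbar_of_pos (p : ℝ) (k : ℕ) (hk : 1 ≤ k) :
    cbar Q N p k = cbar Q N p 0 *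
      (∑ i ∈ Icc 1 k, eqPmf Q N i * cbar Q N p (k - i) + eqTail Q N k) := by
  obtain ⟨m, rfl⟩ : ∃ m, k = m + 1 := ⟨k - 1, by omega⟩
  rw [cbar_zero, cbar,
    Fin.sum_univ_eq_sum_range (fun j => eqPmf Q N (j + 1) * cbar Q N p (m - j)) (m + 1)]
  congr 2
  refine Finset.sum_bij (fun j _ => j + 1) ?_ ?_ ?_ ?_
  · intro j hj
    simp only [Finset.mem_range] at hj
    simp only [Finset.mem_Icc]
    omega
  · intro a _ b _ h
    omega
  · intro b hb
    simp only [Finset.mem_Icc] at hb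
    exact ⟨b - 1, by simp only [Finset.mem_range]; omega, by omega⟩
  · intro j _
    rw [Nat.add_sub_add_right]

end counting

end

end GerberDickson

open GerberDickson

open Filter Topology

namespace GerberDickson

/-! ### Negative binomial probabilities -/

/-! Conditioning on the first claim shows that `ψ` solves `h u = ∑_{y ≤ u} f y * h (u + 1 - y) + P(Y
> u)` (`ruinProbOf_recursion`). The candidate `u ↦ E(C̄_{Z_u})` solves it too
(`nbMean_cbar_recursion`), and both tend to `0`. Their difference is a null sequence dominated by
its own averages, hence zero for `u ≥ 1` (`eq_zero_of_abs_le_average`).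

The candidate's equation rests on two facts. `C̄` satisfies the one-step equation of a walk that
goes up by `1` or down by `N`, with value `1` below zero (`cbar_eq_walk`). A coin-tossing duality
(`nbMean_shiftOne`) turns a downward jump of `Z` by `i` into a claim with law `NegBin(i, p)`;
averaging over `i = N` produces the mixture.

Net profit gives both limits: `C̄_0 = E(Y) < 1` makes the renewal recursion a contraction
(`tendsto_cbar`), and the strong law rules out ruin from every capital at once
(`tendsto_ruinProbOf`). -/

theorem nb_zero_left (p : ℝ) (x : ℕ) : nb 0 p x = if x = 0 then 1 else 0 := by
  cases x with
  | zero => simp [nb]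
  | succ x => simp [nb]

theorem nb_zero_right (k : ℕ) (p : ℝ) : nb k p 0 = p ^ k := by simp [nb]

/-- Pascal's rule, or conditioning on one toss. It also holds at `k = 0`, where truncated
subtraction makes `nb 0 p` the point mass at `0`. -/
theorem nb_succ_succ (k : ℕ) (p : ℝ) (x : ℕ) :
    nb (k + 1) p (x + 1) = p * nb k p (x + 1) + (1 - p) * nb (k + 1) p x := by
  have h1 : k + 1 + (x + 1) - 1 = k + x + 1 := by omega
  have h2 : k + (x + 1) - 1 = k + x := by omega
  have h3 : k + 1 + x - 1 = k + x := by omega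
  simp only [nb, h1, h2, h3, Nat.choose_succ_succ]
  push_cast
  ring

theorem nb_nonneg {p : ℝ} (hp0 : 0 ≤ p) (hp1 : p ≤ 1) (k x : ℕ) : 0 ≤ nb k p x := by
  have : 0 ≤ 1 - p := by linarith
  unfold nb
  positivity

theorem hasSum_nb {p : ℝ} (hp0 : 0 < p) (hp1 : p ≤ 1) (k : ℕ) : HasSum (nb k p) 1 := by
  cases k with
  | zero =>
    have := hasSum_ite_eq (0 : ℕ) (1 : ℝ)
    exact this.congr_fun fun x => nb_zero_left p x
  | succ k =>
    have hn : ‖1 - p‖ < 1 := by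
      rw [Real.norm_eq_abs, abs_lt]
      constructor <;> linarith
    have := (hasSum_choose_mul_geometric_of_norm_lt_one k hn).mul_left (p ^ (k + 1))
    have hne : p ≠ 0 := hp0.ne'
    have e : p ^ (k + 1) * (1 / (1 - (1 - p)) ^ (k + 1)) = 1 := by
      rw [sub_sub_cancel]
      field_simp
    rw [e] at this
    refine this.congr_fun fun x => ?_
    have h3 : k + 1 + x - 1 = x + k := by omega
    have h4 : (x + k).choose x = (x + k).choose k := Nat.choose_symm_add
    simp only [nb, h3, h4]
    ring

theorem nb_le_one {p : ℝ} (hp0 : 0 < p) (hp1 : p ≤ 1) (k x : ℕ) : nb k p x ≤ 1 :=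
  le_hasSum (hasSum_nb hp0 hp1 k) x fun j _ => nb_nonneg hp0.le hp1 k j

/-- Size-biasing raises the first parameter by one, so the mean follows from the total mass of `nb
(k + 1) p`. -/
theorem succ_mul_nb_succ {p : ℝ} (hp0 : p ≠ 0) (k x : ℕ) :
    ((x + 1 : ℕ) : ℝ) * nb k p (x + 1) = k * ((1 - p) / p) * nb (k + 1) p x := by
  have h2 : k + (x + 1) - 1 = k + x := by omega
  have h3 : k + 1 + x - 1 = k + x := by omega
  have key : ((k + x).choose (x + 1) : ℝ) * (x + 1 : ℕ) = (k + x).choose x * k := by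
    have := Nat.choose_succ_right_eq (k + x) x
    rw [Nat.add_sub_cancel] at this
    exact_mod_cast this
  simp only [nb, h2, h3]
  field_simp
  linear_combination (1 - p) ^ (x + 1) * p ^ k * p * key

theorem hasSum_mul_nb {p : ℝ} (hp0 : 0 < p) (hp1 : p ≤ 1) (k : ℕ) :
    HasSum (fun x : ℕ => (x : ℝ) * nb k p x) (k * ((1 - p) / p)) := by
  rw [hasSum_nat_add_iff' 1 |>.symm]
  simp only [range_one, sum_singleton, Nat.cast_zero, zero_mul, sub_zero]
  simp only [succ_mul_nb_succ hp0.ne']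
  simpa using (hasSum_nb hp0 hp1 (k + 1)).mul_left (k * ((1 - p) / p))

/-- For fixed `x` the binomial coefficient grows polynomially in `k`, while `p ^ k` decays
geometrically. -/
theorem tendsto_nb_atTop {p : ℝ} (hp0 : 0 < p) (hp1 : p < 1) (x : ℕ) :
    Tendsto (fun k => nb k p x) atTop (𝓝 0) := by
  have h1 := tendsto_pow_const_mul_const_pow_of_abs_lt_one x
    (show |p| < 1 by rwa [abs_of_pos hp0])
  have h2 : Tendsto (fun k : ℕ => ((k + x : ℕ) : ℝ) ^ x * p ^ (k + x)) atTop (𝓝 0) :=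
    h1.comp (tendsto_add_atTop_nat x)
  have h3 := h2.mul_const ((p ^ x)⁻¹)
  rw [zero_mul] at h3
  refine squeeze_zero (fun k => nb_nonneg hp0.le hp1.le k x) (fun k => ?_) h3
  have hc : ((k + x - 1).choose x : ℝ) ≤ ((k + x : ℕ) : ℝ) ^ x := by
    have : (k + x - 1).choose x ≤ (k + x) ^ x :=
      (Nat.choose_le_pow _ _).trans (Nat.pow_le_pow_left (by omega) x)
    exact_mod_cast this
  have hq : (1 - p) ^ x ≤ 1 := pow_le_one₀ (by linarith) (by linarith)
  have hpx : 0 < p ^ x := pow_pos hp0 x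
  calc nb k p x ≤ ((k + x : ℕ) : ℝ) ^ x * p ^ k * 1 := by
        unfold nb
        gcongr
    _ = _ := by
      rw [pow_add]
      field_simp

/-! ### Expectations under negative binomial laws -/

/-- The expectation of `g` under the negative binomial law `NegBin(m, r)`. -/
noncomputable def nbMean (m : ℕ) (r : ℝ) (g : ℕ → ℝ) : ℝ := ∑' k, nb m r k * g k

theorem summable_nb_mul {r : ℝ} (hr0 : 0 < r) (hr1 : r ≤ 1) {g : ℕ → ℝ} {M : ℝ}
    (hg : ∀ k, |g k| ≤ M) (m : ℕ) : Summable fun k => nb m r k * g k := by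
  refine Summable.of_norm_bounded ((hasSum_nb hr0 hr1 m).summable.mul_right M) fun k => ?_
  rw [norm_mul, Real.norm_eq_abs, Real.norm_eq_abs, abs_of_nonneg (nb_nonneg hr0.le hr1 m k)]
  exact mul_le_mul_of_nonneg_left (hg k) (nb_nonneg hr0.le hr1 m k)

theorem nbMean_zero (r : ℝ) (g : ℕ → ℝ) : nbMean 0 r g = g 0 := by
  simp [nbMean, nb_zero_left]

theorem nbMean_succ {r : ℝ} (hr0 : 0 < r) (hr1 : r ≤ 1) {g : ℕ → ℝ} {M : ℝ}
    (hg : ∀ k, |g k| ≤ M) (m : ℕ) :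
    nbMean (m + 1) r g = r * nbMean m r g + (1 - r) * nbMean (m + 1) r (fun k => g (k + 1)) := by
  have s1 := summable_nb_mul hr0 hr1 hg m
  have s2 := summable_nb_mul hr0 hr1 (fun k => hg (k + 1)) (m + 1)
  have s3 := summable_nb_mul hr0 hr1 hg (m + 1)
  have e : ∀ k, nb (m + 1) r (k + 1) * g (k + 1) =
      r * (nb m r (k + 1) * g (k + 1)) + (1 - r) * (nb (m + 1) r k * g (k + 1)) := by
    intro k
    rw [nb_succ_succ]
    ring
  unfold nbMean
  rw [s3.tsum_eq_zero_add, s1.tsum_eq_zero_add, tsum_congr e,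
    (((summable_nat_add_iff 1).2 s1).mul_left r).tsum_add (s2.mul_left (1 - r)),
    tsum_mul_left, tsum_mul_left, nb_zero_right, nb_zero_right]
  ring

theorem nbMean_nonneg {r : ℝ} (hr0 : 0 ≤ r) (hr1 : r ≤ 1) {g : ℕ → ℝ} (hg : ∀ k, 0 ≤ g k)
    (m : ℕ) : 0 ≤ nbMean m r g :=
  tsum_nonneg fun k => mul_nonneg (nb_nonneg hr0 hr1 m k) (hg k)

/-- As `m` grows the law leaves every finite set (`h1`), and beyond `K` the function is below `ε /
2`. -/
theorem tendsto_nbMean_atTop {r : ℝ} (hr0 : 0 < r) (hr1 : r < 1) {g : ℕ → ℝ}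
    (hg0 : ∀ k, 0 ≤ g k) (hg1 : ∀ k, g k ≤ 1) (hg : Tendsto g atTop (𝓝 0)) :
    Tendsto (fun m => nbMean m r g) atTop (𝓝 0) := by
  have habs : ∀ k, |g k| ≤ 1 := fun k => by rw [abs_of_nonneg (hg0 k)]; exact hg1 k
  rw [Metric.tendsto_atTop]
  intro ε hε
  obtain ⟨K, hK⟩ := (Metric.tendsto_atTop.1 hg) (ε / 2) (by positivity)
  have h1 : Tendsto (fun m => ∑ k ∈ range K, nb m r k) atTop (𝓝 0) := by
    simpa using tendsto_finsetSum (range K) fun k _ => tendsto_nb_atTop hr0 hr1 k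
  obtain ⟨M, hM⟩ := (Metric.tendsto_atTop.1 h1) (ε / 2) (by positivity)
  refine ⟨M, fun m hm => ?_⟩
  have hMm := hM m hm
  rw [Real.dist_0_eq_abs, abs_lt] at hMm
  rw [Real.dist_0_eq_abs, abs_of_nonneg (nbMean_nonneg hr0.le hr1.le hg0 m)]
  have hs := hasSum_nb hr0 hr1.le m
  have hsum := summable_nb_mul hr0 hr1.le habs m
  have htail : ∑' k, nb m r (k + K) * g (k + K) ≤ ε / 2 := by
    have s1 : Summable fun k => nb m r (k + K) := (summable_nat_add_iff K).2 hs.summable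
    calc ∑' k, nb m r (k + K) * g (k + K) ≤ ∑' k, nb m r (k + K) * (ε / 2) := by
          refine Summable.tsum_le_tsum (fun k => ?_)
            ((summable_nat_add_iff K (f := fun k => nb m r k * g k)).2 hsum) (s1.mul_right _)
          refine mul_le_mul_of_nonneg_left ?_ (nb_nonneg hr0.le hr1.le m _)
          have := hK (k + K) (by omega)
          rw [Real.dist_0_eq_abs, abs_lt] at this
          exact this.2.le
      _ = (∑' k, nb m r (k + K)) * (ε / 2) := tsum_mul_right
      _ ≤ 1 * (ε / 2) := by
          gcongr
          have := hs.summable.sum_add_tsum_nat_add K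
          rw [hs.tsum_eq] at this
          have h0 : 0 ≤ ∑ k ∈ range K, nb m r k :=
            sum_nonneg fun k _ => nb_nonneg hr0.le hr1.le m k
          linarith
      _ = ε / 2 := one_mul _
  have hhead : ∑ k ∈ range K, nb m r k * g k ≤ ∑ k ∈ range K, nb m r k :=
    sum_le_sum fun k _ => mul_le_of_le_one_right (nb_nonneg hr0.le hr1.le m k) (hg1 k)
  unfold nbMean
  rw [← hsum.sum_add_tsum_nat_add K]
  linarith [hMm.2]

/-- The function `g` moved to the right by `i`, with the value `1` in the places that become
free. -/
def shiftOne (g : ℕ → ℝ) (i k : ℕ) : ℝ := if k < i then 1 else g (k - i)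

theorem shiftOne_zero (g : ℕ → ℝ) : shiftOne g 0 = g := by
  funext k
  simp [shiftOne]

theorem shiftOne_succ_succ (g : ℕ → ℝ) (i k : ℕ) :
    shiftOne g (i + 1) (k + 1) = shiftOne g i k := by
  simp [shiftOne]

theorem abs_shiftOne_le {g : ℕ → ℝ} (hg : ∀ k, |g k| ≤ 1) (i k : ℕ) : |shiftOne g i k| ≤ 1 := by
  unfold shiftOne
  split_ifs
  · simp
  · exact hg _

/-- In a sequence of coin tosses, let `Z` be the number of failures before the `m`-th success and
`Y` the number of successes before the `i`-th failure. The identity evaluates the mean of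
`g (Z - i)` by conditioning on `Y`; the events `Z < i` and `Y ≥ m` agree. -/
theorem nbMean_shiftOne {r : ℝ} (hr0 : 0 < r) (hr1 : r ≤ 1) {g : ℕ → ℝ}
    (hg : ∀ k, |g k| ≤ 1) (i m : ℕ) (him : 1 ≤ i + m) :
    nbMean m r (shiftOne g i) =
      ∑ y ∈ range m, nb i (1 - r) y * nbMean (m - y) r g +
        (1 - ∑ y ∈ range m, nb i (1 - r) y) := by
  -- Both sides obey the same recursion in `(i, m)`, given by one toss. The pair `(0, 0)` is
  -- excluded: there the left side is `g 0` and the right side is `1`.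
  induction i generalizing m with
  | zero =>
    obtain ⟨n, rfl⟩ : ∃ n, m = n + 1 := ⟨m - 1, by omega⟩
    simp [nb_zero_left, shiftOne_zero]
  | succ i ihi =>
    induction m with
    | zero => simp [nbMean_zero, shiftOne]
    | succ m ihm =>
      rw [nbMean_succ hr0 hr1 (abs_shiftOne_le hg (i + 1)) m, ihm (by omega)]
      simp only [shiftOne_succ_succ]
      rw [ihi (m + 1) (by omega)]
      have e1 : ∀ y, nb (i + 1) (1 - r) (y + 1) =
          (1 - r) * nb i (1 - r) (y + 1) + r * nb (i + 1) (1 - r) y := by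
        intro y
        rw [nb_succ_succ, sub_sub_cancel]
      simp only [sum_range_succ' _ m, e1, nb_zero_right, add_mul, sum_add_distrib, mul_add,
        mul_sub, mul_sum, Nat.add_sub_add_right, mul_assoc, pow_succ']
      ring

/-! ### Uniqueness for the ruin recursion -/

/-- A maximum principle: a null sequence dominated by its own averages vanishes. -/
theorem eq_zero_of_abs_le_average {f d : ℕ → ℝ} (hf : ∀ y, 0 ≤ f y) (hf0 : 0 < f 0)
    (hf1 : ∀ n, ∑ y ∈ range n, f y ≤ 1) (hd : Tendsto d atTop (𝓝 0))
    (h : ∀ u, 1 ≤ u → |d u| ≤ ∑ y ∈ range (u + 1), f y * |d (u + 1 - y)|)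
    (u : ℕ) (hu : 1 ≤ u) : d u = 0 := by
  by_contra hne
  have hpos : 0 < |d u| := abs_pos.2 hne
  have habs : Tendsto (fun n => |d n|) atTop (𝓝 0) := by simpa using hd.abs
  obtain ⟨n0, hn0⟩ := eventually_atTop.1 (habs.eventually_lt_const hpos)
  -- Beyond `n0` the values stay below `|d u|`, so a maximum over a finite range is a maximum over
  -- all `n ≥ 1`.
  obtain ⟨v, hv, hmax⟩ := exists_max_image (Icc 1 (n0 + u)) (fun n => |d n|)
    ⟨u, by simp [hu]⟩
  have hv1 : 1 ≤ v := (mem_Icc.1 hv).1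
  have hle : ∀ n, 1 ≤ n → |d n| ≤ |d v| := by
    intro n hn
    by_cases hnn : n ≤ n0 + u
    · exact hmax n (mem_Icc.2 ⟨hn, hnn⟩)
    · exact (hn0 n (by omega)).le.trans (hmax u (by simp [hu]))
  -- The average at `v + n` gives the positive weight `f 0` to `v + n + 1`, and index `0` never
  -- occurs in it. Hence the maximum propagates one place to the right, which contradicts `d → 0`.
  have hconst : ∀ n, |d (v + n)| = |d v| := by
    intro n
    induction n with
    | zero => rfl
    | succ n ih =>
      refine le_antisymm (hle _ (by omega)) ?_
      have h1 := h (v + n) (by omega)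
      rw [sum_range_succ', ih, Nat.sub_zero] at h1
      have h2 : ∑ y ∈ range (v + n), f (y + 1) * |d (v + n + 1 - (y + 1))| ≤
          (∑ y ∈ range (v + n), f (y + 1)) * |d v| := by
        rw [sum_mul]
        refine sum_le_sum fun y hy => mul_le_mul_of_nonneg_left (hle _ ?_) (hf _)
        have := mem_range.1 hy
        omega
      have h3 := hf1 (v + n + 1)
      rw [sum_range_succ'] at h3
      have h4 : (∑ y ∈ range (v + n), f (y + 1)) * |d v| ≤ (1 - f 0) * |d v| :=
        mul_le_mul_of_nonneg_right (by linarith) (abs_nonneg _)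
      have h5 : f 0 * |d v| ≤ f 0 * |d (v + n + 1)| := by linarith
      exact le_of_mul_le_mul_left h5 hf0
  have h6 : Tendsto (fun n => |d (n + v)|) atTop (𝓝 0) :=
    habs.comp (tendsto_add_atTop_nat v)
  have h7 : Tendsto (fun n => |d (n + v)|) atTop (𝓝 |d v|) := by
    simp only [add_comm _ v, hconst]
    exact tendsto_const_nhds
  have h8 := tendsto_nhds_unique h6 h7
  have h9 := hle u hu
  linarith

/-! ### The counting variable -/

section counting

variable {Ω : Type*} [MeasurableSpace Ω] {Q : Measure Ω} {N : Ω → ℕ}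

theorem pmfOf_nonneg (k : ℕ) : 0 ≤ pmfOf Q N k := measureReal_nonneg

theorem tailOf_nonneg (k : ℕ) : 0 ≤ tailOf Q N k := measureReal_nonneg

theorem tailOf_zero [IsProbabilityMeasure Q] (hN1 : ∀ᵐ ω ∂Q, 1 ≤ N ω) : tailOf Q N 0 = 1 := by
  have h : ({ω | 0 < N ω} : Set Ω) =ᵐ[Q] Set.univ := by
    rw [eventuallyEq_univ]
    filter_upwards [hN1] with ω hω using hω
  rw [tailOf, measureReal_congr h, probReal_univ]

theorem tailOf_eq_add [IsProbabilityMeasure Q] (hN : AEMeasurable N Q) (k : ℕ) :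
    tailOf Q N k = tailOf Q N (k + 1) + pmfOf Q N (k + 1) := by
  have hm : NullMeasurableSet {ω | N ω = k + 1} Q :=
    hN.nullMeasurableSet_preimage (measurableSet_singleton (k + 1))
  have hd : Disjoint {ω | k + 1 < N ω} {ω | N ω = k + 1} := by
    rw [Set.disjoint_left]
    intro ω h1 h2
    simp only [Set.mem_ofPred_eq] at h1 h2
    omega
  rw [tailOf, tailOf, pmfOf, ← measureReal_union₀ hm hd.aedisjoint]
  congr 1
  ext ω
  simp only [Set.mem_ofPred_eq, Set.mem_union]
  omega

/-- `N` is the sum over `k` of the indicators of `k < N`; integrate term by term. -/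
theorem lintegral_eq_tsum_tail (hN : AEMeasurable N Q) :
    ∫⁻ ω, (N ω : ℝ≥0∞) ∂Q = ∑' k, Q {ω | k < N ω} := by
  have h : ∀ ω, (N ω : ℝ≥0∞) = ∑' k, (Set.Ioi k).indicator (fun _ => (1 : ℝ≥0∞)) (N ω) := by
    intro ω
    rw [tsum_eq_sum (s := range (N ω))]
    · rw [sum_congr rfl (g := fun _ => (1 : ℝ≥0∞))]
      · simp
      · intro k hk
        simp [mem_range.1 hk]
    · intro k hk
      simp only [mem_range] at hk
      simp [hk]
  have hm : ∀ k, AEMeasurable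
      (fun ω => (Set.Ioi k).indicator (fun _ => (1 : ℝ≥0∞)) (N ω)) Q := fun k =>
    (measurable_const.indicator measurableSet_Ioi).comp_aemeasurable hN
  rw [lintegral_congr h, lintegral_tsum hm]
  refine tsum_congr fun k => ?_
  have := lintegral_indicator_one₀ (μ := Q) (hN.nullMeasurableSet_preimage
    (measurableSet_Ioi (a := k)))
  rw [show ({ω | k < N ω} : Set Ω) = N ⁻¹' Set.Ioi k from rfl, ← this]
  rfl

theorem ofReal_meanOf (hNint : Integrable (fun ω => (N ω : ℝ)) Q) :
    ENNReal.ofReal (meanOf Q N) = ∫⁻ ω, (N ω : ℝ≥0∞) ∂Q := by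
  rw [meanOf, ofReal_integral_eq_lintegral_ofReal hNint (ae_of_all _ fun ω => Nat.cast_nonneg _)]
  simp

theorem hasSum_tailOf [IsProbabilityMeasure Q] (hN : AEMeasurable N Q)
    (hNint : Integrable (fun ω => (N ω : ℝ)) Q) : HasSum (tailOf Q N) (meanOf Q N) := by
  have h := ofReal_meanOf hNint
  rw [lintegral_eq_tsum_tail hN] at h
  have hne : ∑' k, Q {ω | k < N ω} ≠ ∞ := by
    rw [← h]
    exact ENNReal.ofReal_ne_top
  have h2 := ENNReal.hasSum_toReal hne
  rw [← ENNReal.tsum_toReal_eq fun k => measure_ne_top _ _, ← h, ENNReal.toReal_ofReal] at h2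
  · exact h2
  · exact integral_nonneg fun ω => Nat.cast_nonneg _

theorem one_le_meanOf [IsProbabilityMeasure Q] (hN : AEMeasurable N Q)
    (hN1 : ∀ᵐ ω ∂Q, 1 ≤ N ω) (hNint : Integrable (fun ω => (N ω : ℝ)) Q) :
    1 ≤ meanOf Q N := by
  rw [← tailOf_zero hN1]
  exact le_hasSum (hasSum_tailOf hN hNint) 0 fun j _ => tailOf_nonneg j

theorem sum_pmfOf [IsProbabilityMeasure Q] (hN : AEMeasurable N Q)
    (hN1 : ∀ᵐ ω ∂Q, 1 ≤ N ω) (n : ℕ) :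
    ∑ j ∈ range n, pmfOf Q N (j + 1) = 1 - tailOf Q N n := by
  induction n with
  | zero => simp [tailOf_zero hN1]
  | succ n ih =>
    rw [sum_range_succ, ih, tailOf_eq_add hN n]
    ring

theorem hasSum_pmfOf [IsProbabilityMeasure Q] (hN : AEMeasurable N Q)
    (hN1 : ∀ᵐ ω ∂Q, 1 ≤ N ω) (hNint : Integrable (fun ω => (N ω : ℝ)) Q) :
    HasSum (fun j => pmfOf Q N (j + 1)) 1 := by
  rw [hasSum_iff_tendsto_nat_of_nonneg fun j => pmfOf_nonneg (j + 1)]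
  simp only [sum_pmfOf hN hN1]
  simpa using (hasSum_tailOf hN hNint).summable.tendsto_atTop_zero.const_sub 1

theorem lintegral_eq_tsum_pmfOf [IsProbabilityMeasure Q] (hN : AEMeasurable N Q) :
    ∫⁻ ω, (N ω : ℝ≥0∞) ∂Q = ∑' j : ℕ, ((j + 1 : ℕ) : ℝ≥0∞) * ENNReal.ofReal (pmfOf Q N (j + 1)) := by
  have h := lintegral_map' (μ := Q) (f := fun k : ℕ => (k : ℝ≥0∞)) (g := N)
    (measurable_from_nat.aemeasurable) hN
  rw [← h, lintegral_countable', tsum_eq_zero_add' ENNReal.summable]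
  simp only [Nat.cast_zero, zero_mul, zero_add]
  refine tsum_congr fun j => ?_
  rw [Measure.map_apply_of_aemeasurable hN (measurableSet_singleton _), pmfOf, measureReal_def,
    ENNReal.ofReal_toReal (measure_ne_top _ _)]
  rfl

/-! ### The sequence `cbar` -/

theorem eqPmf_nonneg (i : ℕ) : 0 ≤ eqPmf Q N i :=
  div_nonneg (tailOf_nonneg _) (integral_nonneg fun _ => Nat.cast_nonneg _)

theorem sum_Icc_one_eq_sum_range (f : ℕ → ℝ) (k : ℕ) :
    ∑ i ∈ Icc 1 k, f i = ∑ i ∈ range k, f (i + 1) := by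
  induction k with
  | zero => simp
  | succ k ih => rw [sum_Icc_succ_top (by omega), ih, sum_range_succ]

theorem eqTail_eq (k : ℕ) :
    eqTail Q N k = 1 - (∑ i ∈ range k, tailOf Q N i) / meanOf Q N := by
  simp only [eqTail, sum_Icc_one_eq_sum_range, eqPmf, Nat.add_sub_cancel, sum_div]

theorem eqTail_nonneg [IsProbabilityMeasure Q] (hN : AEMeasurable N Q) (hN1 : ∀ᵐ ω ∂Q, 1 ≤ N ω)
    (hNint : Integrable (fun ω => (N ω : ℝ)) Q) (k : ℕ) : 0 ≤ eqTail Q N k := by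
  have hpos := one_le_meanOf hN hN1 hNint
  have := sum_le_hasSum (range k) (fun j _ => tailOf_nonneg j) (hasSum_tailOf hN hNint)
  rw [eqTail_eq, sub_nonneg]
  exact div_le_one_of_le₀ this (by linarith)

theorem tendsto_eqTail [IsProbabilityMeasure Q] (hN : AEMeasurable N Q) (hN1 : ∀ᵐ ω ∂Q, 1 ≤ N ω)
    (hNint : Integrable (fun ω => (N ω : ℝ)) Q) : Tendsto (eqTail Q N) atTop (𝓝 0) := by
  have hpos := one_le_meanOf hN hN1 hNint
  have h := ((hasSum_tailOf hN hNint).tendsto_sum_nat.div_const (meanOf Q N)).const_sub 1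
  rw [div_self (by linarith), sub_self] at h
  exact h.congr fun k => (eqTail_eq k).symm

/-- This form covers `k = 0` as well, since the sum is then empty and `eqTail Q N 0 = 1`. -/
theorem cbar_eq_mul (p : ℝ) (k : ℕ) :
    cbar Q N p k = cbar Q N p 0 *
      (∑ i ∈ range k, eqPmf Q N (i + 1) * cbar Q N p (k - 1 - i) + eqTail Q N k) := by
  rcases Nat.eq_zero_or_pos k with rfl | hk
  · simp [eqTail]
  · rw [cbar_of_pos Q N p k hk, sum_Icc_one_eq_sum_range]
    simp only [Nat.sub_sub, add_comm 1]

theorem sum_eqPmf_add_eqTail (k : ℕ) :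
    ∑ i ∈ range k, eqPmf Q N (i + 1) + eqTail Q N k = 1 := by
  rw [eqTail, sum_Icc_one_eq_sum_range, add_sub_cancel]

/-- The bracket in the recursion is a convex combination of earlier values and `1`. -/
theorem cbar_nonneg_and_le [IsProbabilityMeasure Q] (hN : AEMeasurable N Q) (hN1 : ∀ᵐ ω ∂Q, 1 ≤ N ω)
    (hNint : Integrable (fun ω => (N ω : ℝ)) Q) {p : ℝ}
    (h0 : 0 ≤ cbar Q N p 0) (h1 : cbar Q N p 0 ≤ 1) (k : ℕ) :
    0 ≤ cbar Q N p k ∧ cbar Q N p k ≤ 1 := by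
  induction k using Nat.strong_induction_on with
  | _ k ih =>
    have hlt : ∀ i ∈ range k, k - 1 - i < k := fun i hi => by
      have := mem_range.1 hi
      omega
    have hT := eqTail_nonneg hN hN1 hNint k
    have hS0 : 0 ≤ ∑ i ∈ range k, eqPmf Q N (i + 1) * cbar Q N p (k - 1 - i) :=
      sum_nonneg fun i hi => mul_nonneg (eqPmf_nonneg _) (ih _ (hlt i hi)).1
    have hS1 : ∑ i ∈ range k, eqPmf Q N (i + 1) * cbar Q N p (k - 1 - i) ≤
        ∑ i ∈ range k, eqPmf Q N (i + 1) :=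
      sum_le_sum fun i hi => mul_le_of_le_one_right (eqPmf_nonneg _) (ih _ (hlt i hi)).2
    have := sum_eqPmf_add_eqTail (Q := Q) (N := N) k
    rw [cbar_eq_mul]
    exact ⟨mul_nonneg h0 (by linarith), mul_le_one₀ h1 (by linarith) (by linarith)⟩

/-- Heuristically the upper limit `L` satisfies `L ≤ ρ * L`. The proof iterates this with the weaker
ratio `(1 + ρ) / 2`, which leaves room for an error. -/
theorem tendsto_cbar [IsProbabilityMeasure Q] (hN : AEMeasurable N Q) (hN1 : ∀ᵐ ω ∂Q, 1 ≤ N ω)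
    (hNint : Integrable (fun ω => (N ω : ℝ)) Q) {p : ℝ}
    (h0 : 0 ≤ cbar Q N p 0) (h1 : cbar Q N p 0 < 1) :
    Tendsto (cbar Q N p) atTop (𝓝 0) := by
  set ρ := cbar Q N p 0 with hρ
  have hb := cbar_nonneg_and_le hN hN1 hNint h0 h1.le
  have step : ∀ n : ℕ, ∃ K, ∀ k ≥ K, cbar Q N p k ≤ ((1 + ρ) / 2) ^ n := by
    intro n
    induction n with
    | zero => exact ⟨0, fun k _ => by simpa using (hb k).2⟩
    | succ n ih =>
      obtain ⟨K, hK⟩ := ih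
      -- This slack is admissible because `(1 + ρ) / 2 - ρ * (1 + (1 - ρ) / 2) = (1 - ρ) ^ 2 / 2`.
      have hpos : 0 < (1 - ρ) / 2 * ((1 + ρ) / 2) ^ n :=
        mul_pos (by linarith) (pow_pos (by linarith) n)
      obtain ⟨J, hJ⟩ := eventually_atTop.1
        ((tendsto_eqTail hN hN1 hNint).eventually_le_const hpos)
      refine ⟨K + J, fun k hk => ?_⟩
      have hbound : ∑ i ∈ range k, eqPmf Q N (i + 1) * cbar Q N p (k - 1 - i) + eqTail Q N k ≤
          ((1 + ρ) / 2) ^ n + (1 - ρ) / 2 * ((1 + ρ) / 2) ^ n := by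
        -- The first `m` terms involve `cbar` at indices at least `K`. The weights of the last `K`
        -- terms, together with `eqTail Q N k`, add up to `eqTail Q N m`, which is within the slack.
        obtain ⟨m, rfl⟩ : ∃ m, k = m + K := ⟨k - K, by omega⟩
        have ha : 0 ≤ ((1 + ρ) / 2) ^ n := pow_nonneg (by linarith) n
        have hm := sum_eqPmf_add_eqTail (Q := Q) (N := N) m
        have hmK := sum_eqPmf_add_eqTail (Q := Q) (N := N) (m + K)
        rw [sum_range_add] at hmK ⊢
        have hA : ∑ i ∈ range m, eqPmf Q N (i + 1) * cbar Q N p (m + K - 1 - i) ≤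
            (∑ i ∈ range m, eqPmf Q N (i + 1)) * ((1 + ρ) / 2) ^ n := by
          rw [sum_mul]
          refine sum_le_sum fun i hi =>
            mul_le_mul_of_nonneg_left (hK _ ?_) (eqPmf_nonneg _)
          have := mem_range.1 hi
          omega
        have hB : ∑ i ∈ range K, eqPmf Q N (m + i + 1) * cbar Q N p (m + K - 1 - (m + i)) ≤
            ∑ i ∈ range K, eqPmf Q N (m + i + 1) :=
          sum_le_sum fun i _ => mul_le_of_le_one_right (eqPmf_nonneg _) (hb _).2
        have hC : (∑ i ∈ range m, eqPmf Q N (i + 1)) * ((1 + ρ) / 2) ^ n ≤ ((1 + ρ) / 2) ^ n :=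
          mul_le_of_le_one_left ha (by linarith [eqTail_nonneg hN hN1 hNint m])
        linarith [hJ m (by omega)]
      have ha : 0 ≤ ((1 + ρ) / 2) ^ n := pow_nonneg (by linarith) n
      rw [cbar_eq_mul, pow_succ']
      refine (mul_le_mul_of_nonneg_left hbound h0).trans ?_
      nlinarith [mul_nonneg (sq_nonneg (1 - ρ)) ha]
  rw [Metric.tendsto_atTop]
  intro ε hε
  obtain ⟨n, hn⟩ := exists_pow_lt_of_lt_one hε (show (1 + ρ) / 2 < 1 by linarith)
  obtain ⟨K, hK⟩ := step n
  refine ⟨K, fun k hk => ?_⟩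
  rw [Real.dist_0_eq_abs, abs_of_nonneg (hb k).1]
  exact (hK k hk).trans_lt hn

/-- The values of `cbar` are the ruin probabilities of the random walk that goes up by `1` with
probability `p` and down by `N` with probability `1 - p`. -/
theorem cbar_eq_walk [IsProbabilityMeasure Q] (hN : AEMeasurable N Q) (hN1 : ∀ᵐ ω ∂Q, 1 ≤ N ω)
    (hNint : Integrable (fun ω => (N ω : ℝ)) Q) {p : ℝ}
    (hp0 : 0 < p) (k : ℕ) :
    cbar Q N p k = p * cbar Q N p (k + 1) +
      (1 - p) * ∑' j, pmfOf Q N (j + 1) * shiftOne (cbar Q N p) (j + 1) k := by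
  have hE := one_le_meanOf hN hN1 hNint
  have hEne : meanOf Q N ≠ 0 := by linarith
  have hpne : p ≠ 0 := hp0.ne'
  -- The recursion cleared of denominators. Its difference between `k` and `k + 1` turns tails into
  -- point probabilities and yields the walk equation.
  have key : ∀ k, p * cbar Q N p k = (1 - p) *
      (∑ i ∈ range k, tailOf Q N i * cbar Q N p (k - 1 - i) + meanOf Q N -
        ∑ i ∈ range k, tailOf Q N i) := by
    intro k
    have e : ∑ i ∈ range k, eqPmf Q N (i + 1) * cbar Q N p (k - 1 - i) =
        (∑ i ∈ range k, tailOf Q N i * cbar Q N p (k - 1 - i)) / meanOf Q N := by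
      rw [sum_div]
      refine sum_congr rfl fun i _ => ?_
      rw [eqPmf, Nat.add_sub_cancel]
      ring
    rw [cbar_eq_mul, e, eqTail_eq, cbar_zero]
    field_simp
    ring
  have hshift : ∑' j, pmfOf Q N (j + 1) * shiftOne (cbar Q N p) (j + 1) k =
      ∑ j ∈ range k, pmfOf Q N (j + 1) * cbar Q N p (k - 1 - j) + tailOf Q N k := by
    have hs := hasSum_pmfOf hN hN1 hNint
    have e1 : ∀ j ∈ range k, pmfOf Q N (j + 1) * shiftOne (cbar Q N p) (j + 1) k =
        pmfOf Q N (j + 1) * cbar Q N p (k - 1 - j) := by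
      intro j hj
      have := mem_range.1 hj
      rw [shiftOne, if_neg (by omega), Nat.sub_sub, add_comm 1]
    have e2 : ∀ j, pmfOf Q N (j + k + 1) * shiftOne (cbar Q N p) (j + k + 1) k =
        pmfOf Q N (j + k + 1) := by
      intro j
      rw [shiftOne, if_pos (by omega), mul_one]
    have hs' : Summable fun j => pmfOf Q N (j + 1) * shiftOne (cbar Q N p) (j + 1) k := by
      rw [← summable_nat_add_iff k]
      simp only [e2]
      exact (summable_nat_add_iff k (f := fun j => pmfOf Q N (j + 1))).2 hs.summable
    have := hs.summable.sum_add_tsum_nat_add k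
    rw [hs.tsum_eq, sum_pmfOf hN hN1] at this
    rw [← hs'.sum_add_tsum_nat_add k, sum_congr rfl e1, tsum_congr e2]
    linarith
  have hk := key k
  have hk1 := key (k + 1)
  rw [sum_range_succ' _ k] at hk1
  have e3 : ∑ i ∈ range k, tailOf Q N (i + 1) * cbar Q N p (k + 1 - 1 - (i + 1)) =
      ∑ i ∈ range k, tailOf Q N i * cbar Q N p (k - 1 - i) -
        ∑ i ∈ range k, pmfOf Q N (i + 1) * cbar Q N p (k - 1 - i) := by
    rw [← sum_sub_distrib]
    refine sum_congr rfl fun i _ => ?_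
    rw [tailOf_eq_add hN i, Nat.add_sub_cancel, Nat.sub_sub k 1 i, add_comm 1 i]
    ring
  rw [e3, tailOf_zero hN1, sum_range_succ, Nat.add_sub_cancel, Nat.sub_zero] at hk1
  rw [hshift]
  linear_combination hk - hk1

/-! ### The recursion for the candidate -/

theorem nbmPmf_nonneg {p : ℝ} (hp0 : 0 ≤ p) (hp1 : p ≤ 1) (x : ℕ) :
    0 ≤ nbmPmf (pmfOf Q N) p x :=
  tsum_nonneg fun _ => mul_nonneg (pmfOf_nonneg _) (nb_nonneg hp0 hp1 _ _)

theorem summable_pmfOf_mul_nb [IsProbabilityMeasure Q] (hN : AEMeasurable N Q) (hN1 : ∀ᵐ ω ∂Q, 1 ≤ N ω)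
    (hNint : Integrable (fun ω => (N ω : ℝ)) Q) {p : ℝ} (hp0 : 0 < p) (hp1 : p ≤ 1) (x : ℕ) :
    Summable fun j => pmfOf Q N (j + 1) * nb (j + 1) p x :=
  Summable.of_nonneg_of_le (fun _ => mul_nonneg (pmfOf_nonneg _) (nb_nonneg hp0.le hp1 _ _))
    (fun _ => mul_le_of_le_one_right (pmfOf_nonneg _) (nb_le_one hp0 hp1 _ _))
    (hasSum_pmfOf hN hN1 hNint).summable

/-- This is the positive weight `f 0` that the maximum principle needs. -/
theorem nbmPmf_zero_pos [IsProbabilityMeasure Q] (hN : AEMeasurable N Q) (hN1 : ∀ᵐ ω ∂Q, 1 ≤ N ω)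
    (hNint : Integrable (fun ω => (N ω : ℝ)) Q) {p : ℝ} (hp0 : 0 < p) (hp1 : p ≤ 1) :
    0 < nbmPmf (pmfOf Q N) p 0 := by
  obtain ⟨j, hj⟩ : ∃ j, 0 < pmfOf Q N (j + 1) := by
    by_contra! h
    have h0 : ∀ j, pmfOf Q N (j + 1) = 0 := fun j => le_antisymm (h j) (pmfOf_nonneg _)
    have hs := hasSum_pmfOf hN hN1 hNint
    simp only [h0] at hs
    exact zero_ne_one (hasSum_zero.unique hs)
  refine (summable_pmfOf_mul_nb hN hN1 hNint hp0 hp1 0).tsum_pos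
    (fun _ => mul_nonneg (pmfOf_nonneg _) (nb_nonneg hp0.le hp1 _ _)) j ?_
  rw [nb_zero_right]
  exact mul_pos hj (pow_pos hp0 _)

theorem nbMean_cbar_recursion [IsProbabilityMeasure Q] (hN : AEMeasurable N Q) (hN1 : ∀ᵐ ω ∂Q, 1 ≤ N ω)
    (hNint : Integrable (fun ω => (N ω : ℝ)) Q) {p : ℝ} (hp0 : 0 < p) (hp1 : p < 1)
    (h0 : 0 ≤ cbar Q N p 0) (h1 : cbar Q N p 0 ≤ 1) (u : ℕ) :
    nbMean u (1 - p) (cbar Q N p) =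
      ∑ y ∈ range (u + 1), nbmPmf (pmfOf Q N) p y * nbMean (u + 1 - y) (1 - p) (cbar Q N p) +
        (1 - ∑ y ∈ range (u + 1), nbmPmf (pmfOf Q N) p y) := by
  set C := cbar Q N p with hC
  set r := 1 - p with hr
  have hr0 : 0 < r := by linarith
  have hr1 : r ≤ 1 := by linarith
  have hrp : 1 - r = p := by linarith
  have hb : ∀ k, |C k| ≤ 1 := fun k => by
    rw [abs_of_nonneg (cbar_nonneg_and_le hN hN1 hNint h0 h1 k).1]
    exact (cbar_nonneg_and_le hN hN1 hNint h0 h1 k).2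
  have hsum := hasSum_pmfOf hN hN1 hNint
  have hnb := hasSum_nb hr0 hr1 (u + 1)
  -- conditioning on the mixing variable
  have hmix : nbMean u r C =
      ∑' j, pmfOf Q N (j + 1) * nbMean (u + 1) r (shiftOne C (j + 1)) := by
    have hsucc := nbMean_succ hr0 hr1 hb u
    rw [hrp] at hsucc
    have hs1 := summable_nb_mul hr0 hr1 hb (u + 1)
    have hs2 := summable_nb_mul hr0 hr1 (fun k => hb (k + 1)) (u + 1)
    have e : ∀ k, nb (u + 1) r k * C k - p * (nb (u + 1) r k * C (k + 1)) =
        r * ∑' j, nb (u + 1) r k * (pmfOf Q N (j + 1) * shiftOne C (j + 1) k) := by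
      intro k
      rw [tsum_mul_left]
      linear_combination nb (u + 1) r k * cbar_eq_walk hN hN1 hNint hp0 k
    -- By `nbMean_succ`, `r * nbMean u r C` is the mean of `C k - p * C (k + 1)` under `NegBin(u +
    -- 1, r)`; the walk equation evaluates this difference.
    have hdiff : r * nbMean u r C =
        r * ∑' k, ∑' j, nb (u + 1) r k * (pmfOf Q N (j + 1) * shiftOne C (j + 1) k) := by
      rw [← tsum_mul_left (a := r), ← tsum_congr e, hs1.tsum_sub (hs2.mul_left p), tsum_mul_left]
      unfold nbMean at hsucc ⊢
      linarith
    have hprod : Summable (Function.uncurry fun k j =>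
        nb (u + 1) r k * (pmfOf Q N (j + 1) * shiftOne C (j + 1) k)) := by
      have hmul := Summable.mul_of_nonneg (f := nb (u + 1) r) (g := fun j => pmfOf Q N (j + 1))
        hnb.summable hsum.summable (fun k => nb_nonneg hr0.le hr1 _ k) (fun j => pmfOf_nonneg _)
      refine Summable.of_norm_bounded hmul fun x => ?_
      simp only [Function.uncurry, norm_mul, Real.norm_eq_abs]
      rw [abs_of_nonneg (nb_nonneg hr0.le hr1 _ _), abs_of_nonneg (pmfOf_nonneg _)]
      exact mul_le_mul_of_nonneg_left
        (mul_le_of_le_one_right (pmfOf_nonneg _) (abs_shiftOne_le hb _ _))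
        (nb_nonneg hr0.le hr1 _ _)
    rw [mul_left_cancel₀ hr0.ne' hdiff, ← hprod.tsum_comm]
    refine tsum_congr fun j => ?_
    rw [nbMean, ← tsum_mul_left]
    exact tsum_congr fun k => by ring
  have hf : ∀ y, HasSum (fun j => pmfOf Q N (j + 1) * nb (j + 1) p y) (nbmPmf (pmfOf Q N) p y) :=
    fun y => (summable_pmfOf_mul_nb hN hN1 hNint hp0 hp1.le y).hasSum
  -- Averaging the duality over `N` replaces each `nb (j + 1) p y` by `nbmPmf (pmfOf Q N) p y`.
  have hfin := (hasSum_sum fun y (_ : y ∈ range (u + 1)) =>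
    (hf y).mul_right (nbMean (u + 1 - y) r C)).add
      (hsum.sub (hasSum_sum fun y (_ : y ∈ range (u + 1)) => hf y))
  rw [hmix, ← hfin.tsum_eq]
  refine tsum_congr fun j => ?_
  rw [nbMean_shiftOne hr0 hr1 hb _ _ (by omega), hrp, mul_add, mul_sub, mul_one, mul_sum, mul_sum]
  simp only [mul_assoc]

end counting

/-! ### Laws given by probability functions -/

theorem lawOfPmf_singleton (f : ℕ → ℝ) (x : ℕ) : lawOfPmf f {x} = ENNReal.ofReal (f x) := by
  rw [lawOfPmf, Measure.sum_apply _ (measurableSet_singleton x), tsum_eq_single x]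
  · simp
  · intro y hy
    simp [hy]

theorem lintegral_lawOfPmf (f : ℕ → ℝ) (g : ℕ → ℝ≥0∞) :
    ∫⁻ x, g x ∂lawOfPmf f = ∑' x, ENNReal.ofReal (f x) * g x := by
  rw [lawOfPmf, lintegral_sum_measure]
  simp

/-- The mean of a negative binomial mixture. -/
theorem lintegral_nbm {Ω : Type*} [MeasurableSpace Ω] {Q : Measure Ω} {N : Ω → ℕ}
    [IsProbabilityMeasure Q] (hN : AEMeasurable N Q) (hN1 : ∀ᵐ ω ∂Q, 1 ≤ N ω)
    (hNint : Integrable (fun ω => (N ω : ℝ)) Q) {p : ℝ} (hp0 : 0 < p) (hp1 : p ≤ 1) :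
    ∫⁻ x, (x : ℝ≥0∞) ∂nbm (pmfOf Q N) p = ENNReal.ofReal (meanOf Q N * (1 - p) / p) := by
  have hnn : ∀ j x, 0 ≤ nb j p x := nb_nonneg hp0.le hp1
  have hE : 0 ≤ meanOf Q N := integral_nonneg fun _ => Nat.cast_nonneg _
  have e1 : ∀ x : ℕ, ENNReal.ofReal (nbmPmf (pmfOf Q N) p x) * (x : ℝ≥0∞) =
      ∑' j, ENNReal.ofReal (pmfOf Q N (j + 1)) * ENNReal.ofReal (x * nb (j + 1) p x) := by
    intro x
    rw [nbmPmf, ENNReal.ofReal_tsum_of_nonneg (fun j => mul_nonneg (pmfOf_nonneg _) (hnn _ _))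
      (summable_pmfOf_mul_nb hN hN1 hNint hp0 hp1 x), ← ENNReal.tsum_mul_right]
    refine tsum_congr fun j => ?_
    rw [ENNReal.ofReal_mul (pmfOf_nonneg _), ENNReal.ofReal_mul (Nat.cast_nonneg x),
      ENNReal.ofReal_natCast]
    ring
  have e2 : ∀ j : ℕ, ∑' x : ℕ, ENNReal.ofReal (x * nb (j + 1) p x) =
      ((j + 1 : ℕ) : ℝ≥0∞) * ENNReal.ofReal ((1 - p) / p) := by
    intro j
    have h := hasSum_mul_nb hp0 hp1 (j + 1)
    rw [← ENNReal.ofReal_tsum_of_nonneg (fun x => mul_nonneg (Nat.cast_nonneg x) (hnn _ _))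
      h.summable, h.tsum_eq, ENNReal.ofReal_mul (Nat.cast_nonneg _), ENNReal.ofReal_natCast]
  rw [nbm, lintegral_lawOfPmf, tsum_congr e1, ENNReal.tsum_comm]
  simp only [ENNReal.tsum_mul_left, e2]
  rw [mul_div_assoc, ENNReal.ofReal_mul hE,
    ofReal_meanOf hNint, lintegral_eq_tsum_pmfOf hN, ← ENNReal.tsum_mul_right]
  exact tsum_congr fun j => by ring

/-! ### The ruin probability -/

/-- The claim sequences `y` that lead to ruin from the initial capital `u`. -/
def ruinSet (u : ℕ) : Set (ℕ → ℕ) := {y | ∃ t, 1 ≤ t ∧ u + t ≤ ∑ i ∈ range t, y i}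

theorem measurableSet_ruinSet (u : ℕ) : MeasurableSet (ruinSet u) := by
  have : ruinSet u = ⋃ t : ℕ, ⋃ _ : 1 ≤ t, {y : ℕ → ℕ | u + t ≤ ∑ i ∈ range t, y i} := by
    ext y
    simp [ruinSet]
  rw [this]
  exact MeasurableSet.iUnion fun t => MeasurableSet.iUnion fun _ =>
    measurableSet_le measurable_const (by fun_prop)

theorem ruinTime_lt_top_iff {Ω : Type*} (Y : ℕ → Ω → ℕ) (u : ℕ) (ω : Ω) :
    ruinTime Y u ω < ⊤ ↔ (fun i => Y i ω) ∈ ruinSet u := by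
  simp only [ruinTime, iInf_lt_iff, ruinSet, Set.mem_ofPred_eq, riskProcess]
  refine exists_congr fun t => ?_
  simp only [ENat.natCast_lt_top, exists_prop, and_true]
  refine and_congr_right fun _ => ?_
  rw [sub_nonpos]
  exact_mod_cast Iff.rfl

/-- Either the first claim already ruins, or the process restarts from the capital `u + 1 - y 0`,
which is at least `1`. -/
theorem mem_ruinSet_iff (u : ℕ) (y : ℕ → ℕ) :
    y ∈ ruinSet u ↔ u + 1 ≤ y 0 ∨ (y 0 ≤ u ∧ (fun i => y (i + 1)) ∈ ruinSet (u + 1 - y 0)) := by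
  constructor
  · rintro ⟨t, ht, h⟩
    obtain ⟨s, rfl⟩ : ∃ s, t = s + 1 := ⟨t - 1, by omega⟩
    rw [sum_range_succ'] at h
    by_cases h0 : u + 1 ≤ y 0
    · exact Or.inl h0
    · refine Or.inr ⟨by omega, s, ?_, by dsimp only; omega⟩
      by_contra hs
      obtain rfl : s = 0 := by omega
      simp at h
      omega
  · rintro (h | ⟨h0, t, ht, h⟩)
    · exact ⟨1, le_rfl, by simpa using h⟩
    · refine ⟨t + 1, by omega, ?_⟩
      rw [sum_range_succ']
      dsimp only at h
      omega

/-- The ruin probability for independent claims with law `μ`. -/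
noncomputable def ruinProbOf (μ : Measure ℕ) (u : ℕ) : ℝ := (Measure.infinitePi fun _ : ℕ => μ).real (ruinSet u)

/-- Ruin depends only on the joint law of the claims, so one may work on the product space, where
the shift is available. -/
theorem ruinProb_eq_ruinProbOf (μ : Measure ℕ) {Ω : Type*} [MeasurableSpace Ω] {P : Measure Ω}
    {Y : ℕ → Ω → ℕ} (hYindep : iIndepFun Y P) (hYlaw : ∀ i, HasLaw (Y i) μ P) (u : ℕ) :
    ruinProb P Y u = ruinProbOf μ u := by
  have hm : AEMeasurable (fun ω i => Y i ω) P :=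
    aemeasurable_pi_iff.2 fun i => (hYlaw i).aemeasurable
  have hlaw := hYindep.hasLaw_infinitePi hYlaw hm
  rw [ruinProb, ruinProbOf, ← hlaw.map_eq,
    map_measureReal_apply_of_aemeasurable hm (measurableSet_ruinSet u)]
  congr 1
  ext ω
  exact ruinTime_lt_top_iff Y u ω

/-- Coordinate `0` is independent of the remaining ones, and the shift preserves the product
measure. -/
theorem infinitePi_cons (μ : Measure ℕ) [IsProbabilityMeasure μ] (a : ℕ) {A : Set (ℕ → ℕ)} (hA : MeasurableSet A) :
    (Measure.infinitePi fun _ : ℕ => μ).real {y | y 0 = a ∧ (fun i => y (i + 1)) ∈ A} =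
      μ.real {a} * (Measure.infinitePi fun _ : ℕ => μ).real A := by
  set Pμ := Measure.infinitePi fun _ : ℕ => μ with hPμ
  have hind : iIndepFun (fun i (y : ℕ → ℕ) => y i) Pμ :=
    iIndepFun_infinitePi (X := fun _ x => x) fun _ => measurable_id
  have hI := indep_iSup_of_disjoint (S := {0}) (T := {0}ᶜ)
    (fun i => (measurable_pi_apply (X := fun _ : ℕ => ℕ) i).comap_le) hind disjoint_compl_right
  have hshift : @Measurable (ℕ → ℕ) (ℕ → ℕ)
      (⨆ i ∈ ({0}ᶜ : Set ℕ), MeasurableSpace.comap (fun y : ℕ → ℕ => y i) inferInstance) _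
      (fun y i => y (i + 1)) := by
    refine (@measurable_pi_iff _ _ _ (_) _ _).2 fun i => ?_
    refine measurable_iff_comap_le.2 (le_iSup₂_of_le (i + 1) (Nat.succ_ne_zero i) le_rfl)
  have h0 : MeasurableSet[⨆ i ∈ ({0} : Set ℕ),
      MeasurableSpace.comap (fun y : ℕ → ℕ => y i) inferInstance] {y : ℕ → ℕ | y 0 = a} :=
    le_iSup₂_of_le (f := fun i _ => MeasurableSpace.comap (fun y : ℕ → ℕ => y i) inferInstance)
      0 (Set.mem_singleton 0) le_rfl _ ⟨{a}, measurableSet_singleton a, rfl⟩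
  have hprod := (Indep_iff _ _ _).1 hI _ _ h0 (hshift hA)
  have h1 : Pμ {y | y 0 = a} = μ {a} := by
    rw [← Measure.infinitePi_map_eval (fun _ : ℕ => μ) 0,
      Measure.map_apply (measurable_pi_apply 0) (measurableSet_singleton a)]
    rfl
  have h2 : Pμ ((fun y i => y (i + 1)) ⁻¹' A) = Pμ A := by
    rw [← Measure.map_apply (by fun_prop) hA, hPμ,
      Measure.map_infinitePi_infinitePi_of_inj (P := fun _ : ℕ => μ) (f := fun i : ℕ => i + 1)
        (add_left_injective 1)]
  rw [h1, h2] at hprod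
  simp only [measureReal_def, ← ENNReal.toReal_mul, ← hprod]
  rfl

theorem ruinProbOf_recursion (μ : Measure ℕ) [IsProbabilityMeasure μ] (u : ℕ) :
    ruinProbOf μ u = ∑ y ∈ range (u + 1), μ.real {y} * ruinProbOf μ (u + 1 - y) +
      (1 - ∑ y ∈ range (u + 1), μ.real {y}) := by
  set Pμ := Measure.infinitePi fun _ : ℕ => μ with hPμ
  have hsplit : ruinSet u = {y | y 0 ∈ range (u + 1)}ᶜ ∪ ⋃ a ∈ range (u + 1),
      {y | y 0 = a ∧ (fun i => y (i + 1)) ∈ ruinSet (u + 1 - a)} := by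
    ext y
    rw [mem_ruinSet_iff]
    simp
  have hmeas : ∀ a, MeasurableSet
      {y : ℕ → ℕ | y 0 = a ∧ (fun i => y (i + 1)) ∈ ruinSet (u + 1 - a)} := fun a =>
    (measurable_pi_apply 0 (measurableSet_singleton a)).inter
      ((show Measurable fun (y : ℕ → ℕ) i => y (i + 1) by fun_prop)
        (measurableSet_ruinSet (u + 1 - a)))
  have hm0 : MeasurableSet {y : ℕ → ℕ | y 0 ∈ range (u + 1)} :=
    measurable_pi_apply 0 (MeasurableSet.of_discrete (s := {a | a ∈ range (u + 1)}))
  have hd : Disjoint {y : ℕ → ℕ | y 0 ∈ range (u + 1)}ᶜ (⋃ a ∈ range (u + 1),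
      {y | y 0 = a ∧ (fun i => y (i + 1)) ∈ ruinSet (u + 1 - a)}) := by
    rw [Set.disjoint_left]
    intro y hy h
    simp only [Set.mem_iUnion] at h
    obtain ⟨a, ha, hya, -⟩ := h
    rw [← hya] at ha
    exact hy ha
  have h0 : Pμ.real {y : ℕ → ℕ | y 0 ∈ range (u + 1)} = ∑ y ∈ range (u + 1), μ.real {y} := by
    rw [sum_measureReal_singleton]
    have := (measurePreserving_eval_infinitePi (fun _ : ℕ => μ) 0).measureReal_preimage
      (MeasurableSet.of_discrete (s := (range (u + 1) : Set ℕ))).nullMeasurableSet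
    rw [← this]
    rfl
  rw [ruinProbOf, ← hPμ, hsplit, measureReal_union hd
    (Finset.measurableSet_biUnion _ fun a _ => hmeas a) (measure_ne_top _ _)
    (measure_ne_top _ _), measureReal_biUnion_finset
      ?_ fun a _ => hmeas a, probReal_compl_eq_one_sub hm0, h0, add_comm]
  · congr 1
    exact sum_congr rfl fun a _ => infinitePi_cons μ a (measurableSet_ruinSet _)
  · intro a _ b _ hab
    refine Set.disjoint_left.2 fun y hy hy' => hab ?_
    exact hy.1.symm.trans hy'.1

/-- The sets `ruinSet u` decrease in `u`, so it suffices that their intersection is null; then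
continuity from above applies. -/
theorem tendsto_ruinProbOf (μ : Measure ℕ) [IsProbabilityMeasure μ] (hμ : ∫⁻ x, (x : ℝ≥0∞) ∂μ < 1) :
    Tendsto (ruinProbOf μ) atTop (𝓝 0) := by
  set Pμ := Measure.infinitePi fun _ : ℕ => μ with hPμ
  have hlaw : ∀ i : ℕ, MeasurePreserving (fun y : ℕ → ℕ => y i) Pμ μ := fun i =>
    measurePreserving_eval_infinitePi (fun _ : ℕ => μ) i
  have hind : iIndepFun (fun i (y : ℕ → ℕ) => y i) Pμ :=
    iIndepFun_infinitePi (X := fun _ x => x) fun _ => measurable_id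
  have hlint : ∫⁻ y, ENNReal.ofReal ((y 0 : ℕ) : ℝ) ∂Pμ = ∫⁻ x, (x : ℝ≥0∞) ∂μ := by
    rw [← (hlaw 0).lintegral_comp measurable_from_nat]
    simp
  have hcast : Measurable fun x : ℕ => (x : ℝ) := measurable_from_nat
  have hint : Integrable (fun y : ℕ → ℕ => (y 0 : ℝ)) Pμ := by
    refine ⟨(hcast.comp (measurable_pi_apply 0)).aestronglyMeasurable, ?_⟩
    rw [hasFiniteIntegral_iff_ofReal (ae_of_all _ fun y => Nat.cast_nonneg _), hlint]
    exact hμ.trans ENNReal.one_lt_top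
  have hmean : ∫ y, (y 0 : ℝ) ∂Pμ < 1 := by
    rw [integral_eq_lintegral_of_nonneg_ae (ae_of_all _ fun y => Nat.cast_nonneg _) hint.1, hlint]
    have := (ENNReal.toReal_lt_toReal hμ.ne_top ENNReal.one_ne_top).2 hμ
    simpa using this
  have hslln := strong_law_ae_real (μ := Pμ) (fun i y => (y i : ℝ)) hint
    (fun i j hij => (hind.indepFun hij).comp hcast hcast)
    fun i => (IdentDistrib.mk (hlaw i).measurable.aemeasurable (hlaw 0).measurable.aemeasurable
      ((hlaw i).map_eq.trans (hlaw 0).map_eq.symm)).comp hcast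
  have hnull : Pμ (⋂ u, ruinSet u) = 0 := by
    refine measure_mono_null ?_ (ae_iff.1 hslln)
    intro y hy hlim
    obtain ⟨T, hT⟩ := eventually_atTop.1 (hlim.eventually_lt_const hmean)
    -- With this capital, ruin by time `T` is impossible because the claims up to `T` cannot exceed
    -- it; after `T` the claims total less than `t`.
    obtain ⟨t, ht, h⟩ := Set.mem_iInter.1 hy (∑ i ∈ range T, y i)
    by_cases htT : t ≤ T
    · have := sum_le_sum_of_subset (f := y) (range_subset_range.2 htT)
      omega
    · have h1 := hT t (by omega)
      rw [div_lt_one (by exact_mod_cast ht)] at h1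
      have h2 : ∑ i ∈ range t, y i < t := by exact_mod_cast h1
      omega
  have hanti : Antitone ruinSet := by
    rintro u v huv y ⟨t, ht, h⟩
    exact ⟨t, ht, by omega⟩
  have hlim := tendsto_measure_iInter_atTop (μ := Pμ)
    (fun u => (measurableSet_ruinSet u).nullMeasurableSet) hanti ⟨0, measure_ne_top _ _⟩
  rw [hnull] at hlim
  have := (ENNReal.tendsto_toReal ENNReal.zero_ne_top).comp hlim
  exact this

end GerberDickson

/-! ### Identification of the ruin probability with the negative binomial mean -/

theorem mainTheorem1
    {Ω Ω' Ω'' : Type*} [MeasurableSpace Ω] [MeasurableSpace Ω'] [MeasurableSpace Ω'']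
    (P : Measure Ω) [IsProbabilityMeasure P]
    (Q : Measure Ω') [IsProbabilityMeasure Q]
    (S : Measure Ω'') [IsProbabilityMeasure S]
    (p : ℝ) (hp0 : 0 < p) (hp1 : p < 1)
    -- the mixing variable `N`, with values in `{1, 2, …}` and finite mean
    (N : Ω' → ℕ) (hN : AEMeasurable N Q) (hN1 : ∀ᵐ ω ∂Q, 1 ≤ N ω)
    (hNint : Integrable (fun ω => (N ω : ℝ)) Q)
    -- i.i.d. claims with distribution `NBM((f_N(1), f_N(2), …), p)`
    (Y : ℕ → Ω → ℕ) (hYindep : iIndepFun Y P)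
    (hYlaw : ∀ i, HasLaw (Y i) (nbm (pmfOf Q N) p) P)
    -- the net profit condition `E(Y) < 1`
    (hnet : ∫⁻ ω, (Y 0 ω : ℝ≥0∞) ∂P < 1)
    (u : ℕ) (hu : 1 ≤ u)
    (Z : Ω'' → ℕ) (hZ : HasLaw Z (negBin u (1 - p)) S) :
    HasSum (fun k => cbar Q N p k * S.real {ω | Z ω = k}) (ruinProb P Y u) ∧
      Integrable (fun ω => cbar Q N p (Z ω)) S ∧
      ruinProb P Y u = ∫ ω, cbar Q N p (Z ω) ∂S := by
  have hμ : IsProbabilityMeasure (nbm (pmfOf Q N) p) :=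
    (hYlaw 0).isProbabilityMeasure_iff.1 inferInstance
  have hmean : ∫⁻ x, (x : ℝ≥0∞) ∂nbm (pmfOf Q N) p < 1 := by
    rwa [← (hYlaw 0).lintegral_comp measurable_from_nat.aemeasurable]
  have hr0 : 0 < 1 - p := by linarith
  have hr1 : 1 - p < 1 := by linarith
  have hρ0 : 0 ≤ cbar Q N p 0 := by
    rw [cbar_zero]
    have := one_le_meanOf hN hN1 hNint
    positivity
  have hρ1 : cbar Q N p 0 < 1 := by
    rw [cbar_zero, ← ENNReal.ofReal_lt_one, ← lintegral_nbm hN hN1 hNint hp0 hp1.le]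
    exact hmean
  have hb := cbar_nonneg_and_le hN hN1 hNint hρ0 hρ1.le
  have habs : ∀ k, |cbar Q N p k| ≤ 1 := fun k => by
    rw [abs_of_nonneg (hb k).1]
    exact (hb k).2
  have hfnn := nbmPmf_nonneg (Q := Q) (N := N) hp0.le hp1.le
  have hf : ∀ x, (nbm (pmfOf Q N) p).real {x} = nbmPmf (pmfOf Q N) p x := fun x => by
    rw [measureReal_def, nbm, lawOfPmf_singleton, ENNReal.toReal_ofReal (hfnn x)]
  have hψ : ruinProb P Y u = nbMean u (1 - p) (cbar Q N p) := by
    rw [ruinProb_eq_ruinProbOf _ hYindep hYlaw, ← sub_eq_zero]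
    refine eq_zero_of_abs_le_average
      (d := fun u => ruinProbOf (nbm (pmfOf Q N) p) u - nbMean u (1 - p) (cbar Q N p))
      hfnn (nbmPmf_zero_pos hN hN1 hNint hp0 hp1.le) (fun n => ?_) ?_ (fun v _ => ?_) u hu
    · simp only [← hf, sum_measureReal_singleton]
      exact measureReal_le_one
    · simpa using (tendsto_ruinProbOf _ hmean).sub (tendsto_nbMean_atTop hr0 hr1
        (fun k => (hb k).1) (fun k => (hb k).2) (tendsto_cbar hN hN1 hNint hρ0 hρ1))
    · have h1 := ruinProbOf_recursion (nbm (pmfOf Q N) p) v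
      have h2 := nbMean_cbar_recursion hN hN1 hNint hp0 hp1 hρ0 hρ1.le v
      simp only [hf] at h1
      -- The inhomogeneous terms `P(Y > v)` cancel, leaving a pure average of the differences.
      rw [h1, h2, add_sub_add_right_eq_sub, ← sum_sub_distrib]
      refine (abs_sum_le_sum_abs _ _).trans_eq (sum_congr rfl fun y _ => ?_)
      rw [← mul_sub, abs_mul, abs_of_nonneg (hfnn y)]
  have hZk : ∀ k, S.real {ω | Z ω = k} = nb u (1 - p) k := fun k => by
    rw [hZ.measureReal_eq (p := fun x => x = k) (measurableSet_singleton k), measureReal_def]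
    change (negBin u (1 - p) {k}).toReal = _
    rw [negBin, lawOfPmf_singleton, ENNReal.toReal_ofReal (nb_nonneg hr0.le hr1.le _ _)]
  have hsum : HasSum (fun k => cbar Q N p k * S.real {ω | Z ω = k}) (ruinProb P Y u) := by
    rw [hψ]
    refine (summable_nb_mul hr0 hr1.le habs u).hasSum.congr_fun fun k => ?_
    rw [hZk, mul_comm]
  have hint : Integrable (fun ω => cbar Q N p (Z ω)) S :=
    Integrable.of_bound (measurable_from_nat.comp_aemeasurable hZ.aemeasurable).aestronglyMeasurable
      1 (ae_of_all _ fun ω => habs (Z ω))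
  refine ⟨hsum, hint, ?_⟩
  have hint' : Integrable (cbar Q N p) (S.map Z) :=
    (integrable_map_measure measurable_from_nat.aestronglyMeasurable hZ.aemeasurable).2 hint
  rw [← integral_map hZ.aemeasurable (f := cbar Q N p) measurable_from_nat.aestronglyMeasurable,
    integral_countable hint', ← hsum.tsum_eq]
  refine tsum_congr fun k => ?_
  rw [map_measureReal_apply_of_aemeasurable hZ.aemeasurable (measurableSet_singleton k),
    smul_eq_mul, mul_comm]
  rfl
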